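/- Setting. Let $g\ge 2$ and let $n_1,\dots,n_g$ be positive integers. There are $g$ groups, the $i$-th consisting of $n_i$ agents, and $m\ge 0$ indivisible items $M=\{1,\dots,m\}$. Each agent $a$ has an additive utility function $u_a:2^M\to\mathbb R_{\ge 0}$. For a positive integer $p$, the 1-out-of-$p$ maximin share of $a$ is $$\max_{(B_1,\dots,B_p)}\ \min_{1\le j\le p} u_a(B_j),$$ the maximum being over all partitions of $M$ into $p$ (possibly empty) bundles. An allocation is an ordered partition $(A_1,\dots,A_g)$ of $M$ into (possibly empty) bundles; it is a 1-out-of-$p$ MMS allocation if, for every $i$, each agent of the $i$-th group has utility for $A_i$ at least her 1-out-of-$p$ maximin share. Let $p_{\mathrm{MMS}}(n_1,\dots,n_g)$ be the smallest positive integer $p$ such that, for all $m$ and all such utility functions of the agents, a 1-out-of-$p$ MMS allocation exists. Write $\log=\log_2$, $n=n_1+\dots+n_g$ and $$\beta_1=\frac{\log(n_1+1)}{\log[(n_2+1)\cdots(n_g+1)]}.$$ Theorem (lower bounds). (1) (Balanced case.) There is an absolute constant $c>0$ such that for all $g\ge 2$ and all positive integers $n_1\ge\dots\ge n_g$ with $\beta_1\le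 1000$, $$p_{\mathrm{MMS}}(n_1,\dots,n_g)\ \ge\ c\,\log[(n_1+1)\cdots(n_g+1)].$$ (2) (Unbalanced case.) There is an absolute constant $c>0$ such that for every $\delta\in(0,1)$ there is $N_0=N_0(\delta)$ with the following property: for all $g\ge 2$ and all positive integers $n_1\ge\dots\ge n_g$ with $\beta_1>1000$, $g\le(\log n)^{1-\delta}$ and $n\ge N_0$, $$p_{\mathrm{MMS}}(n_1,\dots,n_g)\ \ge\ c\,\frac{\log(n_1+1)}{\log\beta_1}.$$ -/

import Mathlib

open Finset

noncomputable section

/-- The additive utility of the bundle `{ℓ | A ℓ = i}`, where `A` is a partition of the items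
`Fin m` into `k` labelled, possibly empty bundles (`A ℓ` is the label of the bundle containing
the item `ℓ`) and `u ℓ` is the utility of the single item `ℓ`. -/
def bundleUtility {m k : ℕ} (u : Fin m → ℝ) (A : Fin m → Fin k) (i : Fin k) : ℝ :=
  ∑ ℓ with A ℓ = i, u ℓ

/-- The `1`-out-of-`p` maximin share of an agent with item utilities `u`: the maximum over all
partitions of the items into `p` bundles of the utility of the worst bundle. It is used only for
`p ≥ 1`, where both index types are finite and nonempty, so that `⨆` is a maximum and `⨅` is a
minimum. -/
def maximinShare {m : ℕ} (p : ℕ) (u : Fin m → ℝ) : ℝ :=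
  ⨆ B : Fin m → Fin p, ⨅ j : Fin p, bundleUtility u B j

/-- The items in `Fin m` are allocated among `g` groups, the `i`-th of which has `n i` agents;
`u i j` are the item utilities of the `j`-th agent of group `i`. The allocation `A` gives the item
`ℓ` to group `A ℓ`. It is a `1`-out-of-`p` MMS allocation if every agent's utility for the bundle
of her group is at least her `1`-out-of-`p` maximin share. -/
def IsMMSAllocation {g m : ℕ} {n : Fin g → ℕ} (p : ℕ)
    (u : (i : Fin g) → Fin (n i) → Fin m → ℝ) (A : Fin m → Fin g) : Prop :=
  ∀ (i : Fin g) (j : Fin (n i)), maximinShare p (u i j) ≤ bundleUtility (u i j) A i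

/-- For groups of sizes `n 0, …, n (g - 1)`, a `1`-out-of-`p` MMS allocation exists for every finite
set of items and all additive, nonnegative utilities of the agents. -/
def MMSGuaranteed {g : ℕ} (n : Fin g → ℕ) (p : ℕ) : Prop :=
  ∀ (m : ℕ) (u : (i : Fin g) → Fin (n i) → Fin m → ℝ),
    (∀ i j ℓ, 0 ≤ u i j ℓ) → ∃ A : Fin m → Fin g, IsMMSAllocation p u A

/-- `p_MMS(n₁, …, n_g)`: the smallest positive integer `p` such that a `1`-out-of-`p` MMS allocation
always exists. (If there were no such `p`, this would be `0`; hence a positive lower bound on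
`pMMS n` includes the fact that such a `p` exists.) -/
def pMMS {g : ℕ} (n : Fin g → ℕ) : ℕ :=
  sInf {p : ℕ | 0 < p ∧ MMSGuaranteed n p}

/-- `log₂ (n₁ + 1)`, where `n₁` is the size of the first group. -/
def logFirst {g : ℕ} (hg : 2 ≤ g) (n : Fin g → ℕ) : ℝ :=
  Real.logb 2 ((n ⟨0, by omega⟩ : ℝ) + 1)

/-- `log₂ [(n₂ + 1) ⋯ (n_g + 1)]`, the product being over all groups except the first one. -/
def logRest {g : ℕ} (n : Fin g → ℕ) : ℝ :=
  Real.logb 2 (∏ i : Fin g with i.val ≠ 0, ((n i : ℝ) + 1))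

/-- `log₂ [(n₁ + 1) ⋯ (n_g + 1)]`. -/
def logAll {g : ℕ} (n : Fin g → ℕ) : ℝ :=
  Real.logb 2 (∏ i, ((n i : ℝ) + 1))

/-- The balancedness ratio `β₁ = log (n₁ + 1) / log [(n₂ + 1) ⋯ (n_g + 1)]`. -/
def betaOne {g : ℕ} (hg : 2 ≤ g) (n : Fin g → ℕ) : ℝ :=
  logFirst hg n / logRest n

end

/-! A bundle has to be large in order to satisfy a group, and bundles are disjoint. So it is enough
to find utilities for which the groups together demand more items than there are; here a group
demands `t` items if each bundle of fewer than `t` items fails one of its agents (`CanDemand`).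

All utilities are `0` or `1` on items. An agent who values exactly the items of a set `T` with
`p` or more elements must get an item of `T`. On `m = 2 * p * q` items this gives two kinds of
demands. A group of at least `m.choose p` agents can contain all sets of `p` items, so it demands
`m - p + 1` items (`canDemand_of_choose_le`). Up to constant factors, any group of size `n` demands
`q * (log (n / q + 1) + 1)` items, or `q * p` if that is less (`canDemand_log`): the items are cut
into `q` chunks of size `2 * p` and each chunk is cut into `4 * s` blocks, where `s` is about
`log (n / q) / 4`; a bundle with at most `s` items in some chunk misses at least `p` items of that
chunk forming a union of blocks.

In the balanced case, `q = 1`: the demands of all groups but the first add up to a multiple of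
`logRest n`, unless two groups demand more than half of the `2 * p` items each. In the unbalanced
case, `q` is `β₁` rounded up. If `p` is less than `log (n₁ + 1) / (8 * log β₁)`, then
`m.choose p ≤ (8 * q) ^ p ≤ n₁`, so the first group demands `m - p + 1` items, while each other
group demands at least `q * log (n i + 1) / (8 * log β₁)`, or more than `p`. The latter demands add
up to at least `log (n₁ + 1) / (8 * log β₁)`, or at any rate to at least `p`.

These arguments bound every `p` for which an allocation is guaranteed. That such a `p` exists, so
that `pMMS n` is one, follows by bag filling with twice as many shares as agents
(`mmsGuaranteed_two_mul_card`). -/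

/-! ### A sufficient number of shares -/

/-- Bag filling. If no agent values a single item above her target `μ a`, and each of the `#T`
agents values all items at `2 * #T` times her target, then the items can be handed out so that all
targets are met: a minimal bag meeting some target is worth at most `2 * μ b` to everybody else. -/
theorem exists_owner_of_two_mul_card_mul_le {α ι : Type*} [DecidableEq α] [DecidableEq ι]
    [Nonempty ι] (v : ι → α → ℝ) (μ : ι → ℝ) (hv : ∀ a x, 0 ≤ v a x) (hvμ : ∀ a x, v a x ≤ μ a)
    (hμ : ∀ a, 0 ≤ μ a) (k : ℕ) :
    ∀ (T : Finset ι) (S : Finset α), #T = k → (∀ a ∈ T, 2 * k * μ a ≤ ∑ x ∈ S, v a x) →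
      ∃ o : α → ι, ∀ a ∈ T, μ a ≤ ∑ x ∈ S with o x = a, v a x := by
  induction k with
  | zero =>
    intro T S hT _
    rw [Finset.card_eq_zero] at hT
    exact ⟨fun _ => Classical.arbitrary ι, by simp [hT]⟩
  | succ k ih =>
    intro T S hT h
    have hS : ∃ B ⊆ S, ∃ a ∈ T, μ a ≤ ∑ x ∈ B, v a x := by
      obtain ⟨a, ha⟩ : T.Nonempty := Finset.card_pos.mp (by omega)
      refine ⟨S, Subset.rfl, a, ha, le_trans ?_ (h a ha)⟩
      have := mul_nonneg (Nat.cast_nonneg (α := ℝ) k) (hμ a)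
      push_cast
      linarith [hμ a]
    obtain ⟨B, ⟨hBS, a, haT, ha⟩, hmin⟩ :=
      WellFounded.has_min (wellFounded_lt (α := Finset α))
        {B | B ⊆ S ∧ ∃ a ∈ T, μ a ≤ ∑ x ∈ B, v a x} hS
    have hB : ∀ b ∈ T, ∑ x ∈ B, v b x ≤ 2 * μ b := by
      intro b hb
      rcases B.eq_empty_or_nonempty with rfl | ⟨x, hx⟩
      · simpa using hμ b
      · have h1 : ∑ y ∈ B.erase x, v b y < μ b := by
          by_contra! hcon
          exact hmin (B.erase x) ⟨(Finset.erase_subset _ _).trans hBS, b, hb, hcon⟩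
            (Finset.erase_ssubset hx)
        rw [← Finset.add_sum_erase B _ hx]
        linarith [hvμ b x]
    obtain ⟨o, ho⟩ := ih (T.erase a) (S \ B) (by rw [Finset.card_erase_of_mem haT]; omega) (by
      intro b hb
      have hbT := Finset.mem_of_mem_erase hb
      have h1 := h b hbT
      have h2 := hB b hbT
      have h3 := Finset.sum_sdiff (f := v b) hBS
      push_cast at h1
      linarith)
    refine ⟨fun x => if x ∈ B then a else o x, fun b hb => ?_⟩
    by_cases hba : b = a
    · subst hba
      refine ha.trans (Finset.sum_le_sum_of_subset_of_nonneg ?_ fun x _ _ => hv b x)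
      intro x hx
      simp [hx, hBS hx]
    · refine (ho b (Finset.mem_erase.mpr ⟨hba, hb⟩)).trans
        (Finset.sum_le_sum_of_subset_of_nonneg ?_ fun x _ _ => hv b x)
      intro x hx
      simp only [Finset.mem_filter, Finset.mem_sdiff] at hx ⊢
      simp [hx.1.1, hx.1.2, hx.2]

theorem bundleUtility_nonneg {m k : ℕ} {u : Fin m → ℝ} (hu : ∀ ℓ, 0 ≤ u ℓ) (A : Fin m → Fin k)
    (i : Fin k) : 0 ≤ bundleUtility u A i :=
  Finset.sum_nonneg fun ℓ _ => hu ℓ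

theorem exists_maximinShare_le_bundleUtility {m p : ℕ} (hp : 0 < p) (u : Fin m → ℝ) :
    ∃ B : Fin m → Fin p, ∀ j, maximinShare p u ≤ bundleUtility u B j := by
  have : Nonempty (Fin p) := ⟨⟨0, hp⟩⟩
  obtain ⟨B, hB⟩ := exists_eq_ciSup_of_finite
    (f := fun B : Fin m → Fin p => ⨅ j : Fin p, bundleUtility u B j)
  refine ⟨B, fun j => ?_⟩
  rw [maximinShare, ← hB]
  exact ciInf_le (Set.finite_range _).bddBelow j

theorem le_maximinShare {m p : ℕ} (hp : 0 < p) {u : Fin m → ℝ} {x : ℝ} (B : Fin m → Fin p)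
    (h : ∀ j, x ≤ bundleUtility u B j) : x ≤ maximinShare p u := by
  have : Nonempty (Fin p) := ⟨⟨0, hp⟩⟩
  exact (le_ciInf h).trans
    (le_ciSup (f := fun B : Fin m → Fin p => ⨅ j : Fin p, bundleUtility u B j)
      (Set.finite_range _).bddAbove B)

theorem maximinShare_nonneg {m p : ℕ} (hp : 0 < p) {u : Fin m → ℝ} (hu : ∀ ℓ, 0 ≤ u ℓ) :
    0 ≤ maximinShare p u :=
  le_maximinShare hp (fun _ => ⟨0, hp⟩) fun _ => bundleUtility_nonneg hu _ _

/-- Twice the number of agents is always a sufficient number of shares. -/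
theorem mmsGuaranteed_two_mul_card {g : ℕ} (n : Fin g → ℕ) [Nonempty (Σ i, Fin (n i))] :
    MMSGuaranteed n (2 * Fintype.card (Σ i, Fin (n i))) := by
  intro m u hu
  set N := Fintype.card (Σ i, Fin (n i)) with hN
  have hp : 0 < 2 * N := by have : 0 < N := Fintype.card_pos; omega
  let μ : (Σ i, Fin (n i)) → ℝ := fun a => maximinShare (2 * N) (u a.1 a.2)
  have hμ : ∀ a, 0 ≤ μ a := fun a => maximinShare_nonneg hp (hu a.1 a.2)
  -- Utilities are truncated at the share; a bundle worth the share keeps that value.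
  let v : (Σ i, Fin (n i)) → Fin m → ℝ := fun a ℓ => min (u a.1 a.2 ℓ) (μ a)
  have hv : ∀ a ℓ, 0 ≤ v a ℓ := fun a ℓ => le_min (hu _ _ _) (hμ a)
  obtain ⟨o, ho⟩ := exists_owner_of_two_mul_card_mul_le v μ hv (fun a ℓ => min_le_right _ _) hμ N
    Finset.univ Finset.univ (by simp [hN]) (by
      intro a _
      obtain ⟨B, hB⟩ := exists_maximinShare_le_bundleUtility hp (u a.1 a.2)
      have hfib : ∀ j, μ a ≤ ∑ ℓ with B ℓ = j, v a ℓ := by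
        intro j
        by_cases hbig : ∃ ℓ, B ℓ = j ∧ μ a ≤ u a.1 a.2 ℓ
        · obtain ⟨ℓ, hℓ, hle⟩ := hbig
          calc μ a = v a ℓ := (min_eq_right hle).symm
            _ ≤ _ := Finset.single_le_sum (fun x _ => hv a x) (by simp [hℓ])
        · push Not at hbig
          refine (hB j).trans (le_of_eq (Finset.sum_congr rfl fun ℓ hℓ => ?_))
          exact (min_eq_left (hbig ℓ (Finset.mem_filter.mp hℓ).2).le).symm
      have hsum := Finset.sum_le_sum fun (j : Fin (2 * N)) (_ : j ∈ Finset.univ) => hfib j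
      rw [Finset.sum_fiberwise] at hsum
      simpa using hsum)
  refine ⟨fun ℓ => (o ℓ).1, fun i j => (ho ⟨i, j⟩ (Finset.mem_univ _)).trans ?_⟩
  calc ∑ ℓ with o ℓ = ⟨i, j⟩, v ⟨i, j⟩ ℓ ≤ ∑ ℓ with o ℓ = ⟨i, j⟩, u i j ℓ :=
        Finset.sum_le_sum fun ℓ _ => min_le_left _ _
    _ ≤ _ := Finset.sum_le_sum_of_subset_of_nonneg (by
        intro ℓ hℓ
        simp only [Finset.mem_filter, Finset.mem_univ, true_and] at hℓ ⊢
        rw [hℓ]) fun ℓ _ _ => hu i j ℓ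

theorem pMMS_pos_and_mmsGuaranteed {g : ℕ} (hg : 2 ≤ g) {n : Fin g → ℕ} (hn : ∀ i, 1 ≤ n i) :
    0 < pMMS n ∧ MMSGuaranteed n (pMMS n) := by
  have : Nonempty (Σ i, Fin (n i)) := ⟨⟨⟨0, by omega⟩, ⟨0, hn _⟩⟩⟩
  exact Nat.sInf_mem (s := {p : ℕ | 0 < p ∧ MMSGuaranteed n p})
    ⟨_, Nat.mul_pos two_pos Fintype.card_pos, mmsGuaranteed_two_mul_card n⟩

/-! ### Groups that demand many items -/

/-- A group of `n` agents can demand `t` of `m` items: for suitable nonnegative utilities, every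
bundle of fewer than `t` items is worth less than the `1`-out-of-`p` maximin share to some agent of
the group. -/
def CanDemand (n m p t : ℕ) : Prop :=
  ∃ u : Fin n → Fin m → ℝ, (∀ j ℓ, 0 ≤ u j ℓ) ∧
    ∀ S : Finset (Fin m), #S < t → ∃ j, ∑ ℓ ∈ S, u j ℓ < maximinShare p (u j)

/-- Bundles are disjoint, so the demands of the groups must fit into the set of items. -/
theorem sum_le_of_mmsGuaranteed {g m p : ℕ} {n t : Fin g → ℕ} (h : MMSGuaranteed n p)
    (ht : ∀ i, CanDemand (n i) m p (t i)) : ∑ i, t i ≤ m := by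
  choose u hu hfail using ht
  obtain ⟨A, hA⟩ := h m u hu
  calc ∑ i, t i ≤ ∑ i, #{ℓ | A ℓ = i} := by
        refine Finset.sum_le_sum fun i _ => ?_
        by_contra! hlt
        obtain ⟨j, hj⟩ := hfail i _ hlt
        exact (hA i j).not_gt hj
    _ = m := by
        rw [← Finset.card_eq_sum_card_fiberwise (fun _ _ => Finset.mem_coe.mpr (Finset.mem_univ _))]
        simp

theorem le_maximinShare_indicator {m p k : ℕ} (hp : 0 < p) (T : Finset (Fin m))
    (hT : p * k ≤ #T) : (k : ℝ) ≤ maximinShare p (fun ℓ => if ℓ ∈ T then 1 else 0) := by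
  obtain ⟨f⟩ : Nonempty (Fin p × Fin k ↪ T) :=
    Function.Embedding.nonempty_of_card_le (by simpa using hT)
  let f' : Fin p × Fin k → Fin m := fun x => f x
  have hf' : Function.Injective f' := Subtype.val_injective.comp f.injective
  refine le_maximinShare hp (Function.extend f' Prod.fst fun _ => ⟨0, hp⟩) fun j => ?_
  calc (k : ℝ) = ∑ ℓ ∈ Finset.univ.image fun y : Fin k => f' (j, y),
        if ℓ ∈ T then (1 : ℝ) else 0 := by
        rw [Finset.sum_image fun a _ b _ hab => (Prod.mk.inj (hf' hab)).2]
        simp [f']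
    _ ≤ _ := by
        refine Finset.sum_le_sum_of_subset_of_nonneg ?_ fun ℓ _ _ => by positivity
        intro ℓ hℓ
        obtain ⟨y, -, rfl⟩ := Finset.mem_image.mp hℓ
        simp [hf'.extend_apply]

/-- Agents who value precisely the items of one of the sets `T i` demand `t` items, if every set of
fewer than `t` items misses some `T i` with at least `p` elements. -/
theorem canDemand_of_family {n m p t : ℕ} (hp : 0 < p) {α ι : Type*} [DecidableEq α]
    [Fintype ι] [Nonempty ι] (e : Fin m ≃ α) (hι : Fintype.card ι ≤ n) (T : ι → Finset α)
    (h : ∀ S : Finset α, #S < t → ∃ i, p ≤ #(T i) ∧ Disjoint (T i) S) : CanDemand n m p t := by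
  obtain ⟨σ⟩ : Nonempty (ι ↪ Fin n) := Function.Embedding.nonempty_of_card_le (by simpa using hι)
  let T' : ι → Finset (Fin m) := fun i => (T i).map e.symm.toEmbedding
  refine ⟨fun j ℓ => if ℓ ∈ T' (Function.invFun σ j) then 1 else 0, fun j ℓ => by positivity,
    fun S hS => ?_⟩
  obtain ⟨i, hi, hdisj⟩ := h (S.map e.toEmbedding) (by simpa using hS)
  refine ⟨σ i, ?_⟩
  simp only [Function.leftInverse_invFun σ.injective i]
  have h1 := le_maximinShare_indicator (k := 1) hp (T' i) (by simpa [T'] using hi)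
  refine lt_of_lt_of_le ?_ h1
  rw [Finset.sum_eq_zero]
  · norm_num
  · intro ℓ hℓ
    rw [if_neg]
    intro hmem
    obtain ⟨x, hx, rfl⟩ := Finset.mem_map.mp hmem
    exact Finset.disjoint_left.mp hdisj hx (Finset.mem_map.mpr ⟨_, hℓ, by simp⟩)

/-- A single agent who values all items equally demands a fraction `1 / p` of them. -/
theorem canDemand_of_mul_le {n m p k : ℕ} (hp : 0 < p) (hn : 1 ≤ n) (h : p * k ≤ m) :
    CanDemand n m p k := by
  refine ⟨fun _ ℓ => if ℓ ∈ (Finset.univ : Finset (Fin m)) then 1 else 0,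
    fun _ _ => by simp, fun S hS => ⟨⟨0, hn⟩, ?_⟩⟩
  refine lt_of_lt_of_le ?_ (le_maximinShare_indicator (k := k) hp Finset.univ (by simpa using h))
  simpa using hS

/-- If all sets of `p` items are represented in the group, then at most `p - 1` items may be
withheld from it. -/
theorem canDemand_of_choose_le {n m p : ℕ} (hp : 0 < p) (hpm : p ≤ m) (h : m.choose p ≤ n) :
    CanDemand n m p (m - p + 1) := by
  let ι := {T // T ∈ Finset.powersetCard p (Finset.univ : Finset (Fin m))}
  have : Nonempty ι := by
    obtain ⟨T, hT⟩ := Finset.powersetCard_nonempty.mpr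
      (show p ≤ #(Finset.univ : Finset (Fin m)) by simpa using hpm)
    exact ⟨⟨T, hT⟩⟩
  refine canDemand_of_family (ι := ι) hp (Equiv.refl _) (by simpa [ι] using h)
    (fun T => T.1) fun S hS => ?_
  obtain ⟨T, hTS, hT⟩ := Finset.exists_subset_card_eq (s := Sᶜ) (n := p) (by
    rw [Finset.card_compl, Fintype.card_fin]; omega)
  exact ⟨⟨T, Finset.mem_powersetCard.mpr ⟨Finset.subset_univ _, hT⟩⟩, hT.ge,
    Finset.disjoint_left.mpr fun x hx => Finset.mem_compl.mp (hTS hx)⟩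

/-- The items form `q` chunks of size `2 * p`, and each chunk is cut into at most `4 * s` blocks of
at most `p / s` items; the agents value the unions of blocks of one chunk. A bundle of fewer than
`q * (s + 1)` items meets at most `s` blocks of some chunk, so it misses `p` items of that chunk
which form a union of blocks. -/
theorem canDemand_of_mul_pow_le {n p q s : ℕ} (hs : 0 < s) (hsp : s ≤ p) (hq : 0 < q)
    (h : q * 16 ^ s ≤ n) : CanDemand n (q * (2 * p)) p (q * (s + 1)) := by
  have hD : 0 < p / s := Nat.div_pos hsp hs
  have hDp : s * (p / s) ≤ p := Nat.mul_div_le p s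
  have hpD : 2 * p < 4 * s * (p / s) := by
    have h1 := Nat.lt_mul_div_succ p hs
    have h2 : s * (p / s + 1) ≤ s * (2 * (p / s)) := Nat.mul_le_mul_left s (by omega)
    calc 2 * p < 2 * (s * (2 * (p / s))) := by omega
      _ = 4 * s * (p / s) := by ring
  set D := p / s
  let b : Fin (2 * p) → Fin (4 * s) := fun y =>
    ⟨y / D, (Nat.div_lt_iff_lt_mul hD).mpr (y.2.trans hpD)⟩
  have hb : ∀ c, #{y | b y = c} ≤ D := by
    intro c
    refine (Finset.card_le_card_of_injOn (t := Finset.range D) (fun y : Fin (2 * p) => (y : ℕ) % D)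
      (fun y _ => by simpa using Nat.mod_lt _ hD) ?_).trans (Finset.card_range D).le
    intro x hx y hy hxy
    simp only [Finset.coe_filter, Finset.mem_univ, true_and, Set.mem_ofPred_eq] at hx hy
    have hdiv : (x : ℕ) / D = y / D := congrArg Fin.val (hx.trans hy.symm)
    have hmod : (x : ℕ) % D = y % D := hxy
    apply Fin.ext
    rw [← Nat.div_add_mod (x : ℕ) D, ← Nat.div_add_mod (y : ℕ) D, hdiv, hmod]
  have : Nonempty (Fin q) := ⟨⟨0, hq⟩⟩
  refine canDemand_of_family (ι := Fin q × Finset (Fin (4 * s))) (by omega)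
    finProdFinEquiv.symm ?_
    (fun i => {x | x.1 = i.1 ∧ b x.2 ∈ i.2}) fun S hS => ?_
  · simpa [pow_mul] using h
  · obtain ⟨c, -, hc⟩ := Finset.exists_card_fiber_lt_of_card_lt_mul (s := S)
      (t := (Finset.univ : Finset (Fin q))) (f := Prod.fst) (n := s + 1) (by simpa using hS)
    let hit : Finset (Fin (4 * s)) := {x ∈ S | x.1 = c}.image fun x => b x.2
    have hhit : #hit ≤ s := Finset.card_image_le.trans (Nat.lt_succ_iff.mp hc)
    refine ⟨(c, hitᶜ), ?_, ?_⟩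
    · have h1 : #{y : Fin (2 * p) | b y ∈ hit} ≤ p := by
        calc _ ≤ D * #hit := Finset.card_le_mul_card_image_of_maps_to
                (f := b) (by simp) D (fun a _ => (Finset.card_le_card (by
                  intro y; simp +contextual)).trans (hb a))
          _ ≤ D * s := Nat.mul_le_mul_left _ hhit
          _ ≤ p := by rwa [mul_comm]
      have h2 : p ≤ #{y : Fin (2 * p) | ¬ b y ∈ hit} := by
        have := Finset.card_filter_add_card_filter_not
          (s := (Finset.univ : Finset (Fin (2 * p)))) (fun y => b y ∈ hit)
        rw [Finset.card_univ, Fintype.card_fin] at this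
        omega
      refine h2.trans (Finset.card_le_card_of_injOn (fun y => (c, y)) ?_ fun x _ y _ hxy =>
        (Prod.mk.inj hxy).2)
      intro y hy
      simpa using hy
    · refine Finset.disjoint_left.mpr fun x hx hxS => ?_
      simp only [Finset.mem_filter, Finset.mem_univ, true_and, Finset.mem_compl] at hx
      exact hx.2 (Finset.mem_image.mpr ⟨x, by simp [hxS, hx.1], rfl⟩)

theorem canDemand_log {n p q : ℕ} (hn : 1 ≤ n) (hp : 0 < p) (hq : 0 < q) :
    CanDemand n (q * (2 * p)) p (q * (min p (Nat.log 16 (n / q)) + 1)) := by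
  rcases Nat.eq_zero_or_pos (min p (Nat.log 16 (n / q))) with h0 | hs
  · rw [h0]
    exact canDemand_of_mul_le hp hn (by nlinarith)
  · refine canDemand_of_mul_pow_le hs (min_le_left _ _) hq ?_
    have hnq : n / q ≠ 0 := by
      intro h0
      simp [h0] at hs
    calc q * 16 ^ min p (Nat.log 16 (n / q)) ≤ q * (n / q) :=
          Nat.mul_le_mul_left _ ((Nat.pow_le_pow_right (by norm_num) (min_le_right _ _)).trans
            (Nat.pow_log_le_self _ hnq))
      _ ≤ n := Nat.mul_div_le n q

theorem logb_add_one_le {n q : ℕ} (hq : 0 < q) :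
    Real.logb 2 ((n : ℝ) + 1) ≤ Real.logb 2 q + 4 * ((Nat.log 16 (n / q) : ℝ) + 1) := by
  have h1 : n + 1 ≤ q * 16 ^ (Nat.log 16 (n / q) + 1) := by
    have h2 := Nat.lt_pow_succ_log_self (b := 16) (by norm_num) (n / q)
    exact (Nat.div_lt_iff_lt_mul hq).mp h2 |>.trans_eq (mul_comm _ _)
  have hq' : (0 : ℝ) < q := by exact_mod_cast hq
  have h2 : (n : ℝ) + 1 ≤ q * 2 ^ (4 * (Nat.log 16 (n / q) + 1)) := by
    rw [pow_mul]
    norm_num only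
    exact_mod_cast h1
  calc Real.logb 2 ((n : ℝ) + 1) ≤ Real.logb 2 (q * 2 ^ (4 * (Nat.log 16 (n / q) + 1))) :=
        Real.logb_le_logb_of_le (by norm_num) (by positivity) h2
    _ = _ := by
        rw [Real.logb_mul hq'.ne' (by positivity), Real.logb_pow, Real.logb_self_eq_one (by norm_num)]
        push_cast
        ring

/-! ### Logarithms of the group sizes -/

theorem logRest_eq_sum {g : ℕ} (n : Fin g → ℕ) :
    logRest n = ∑ i : Fin g with i.val ≠ 0, Real.logb 2 ((n i : ℝ) + 1) := by
  rw [logRest, Real.logb_prod]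
  intro i _
  positivity

theorem filter_val_ne_zero {g : ℕ} (hg : 2 ≤ g) :
    (Finset.univ.filter fun i : Fin g => i.val ≠ 0) =
      Finset.univ.erase (⟨0, by omega⟩ : Fin g) := by
  ext i
  simp [Fin.ext_iff]

theorem logAll_eq_add {g : ℕ} (hg : 2 ≤ g) (n : Fin g → ℕ) :
    logAll n = logFirst hg n + logRest n := by
  rw [logRest_eq_sum, filter_val_ne_zero hg, logAll, Real.logb_prod, logFirst,
    Finset.add_sum_erase _ (fun i => Real.logb 2 ((n i : ℝ) + 1)) (Finset.mem_univ _)]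
  intro i _
  positivity

theorem one_le_logRest {g : ℕ} (hg : 2 ≤ g) {n : Fin g → ℕ} (hn : ∀ i, 1 ≤ n i) :
    1 ≤ logRest n := by
  rw [logRest_eq_sum]
  have h : ∀ i, 1 ≤ Real.logb 2 ((n i : ℝ) + 1) := fun i => by
    rw [Real.le_logb_iff_rpow_le (by norm_num) (by positivity), Real.rpow_one]
    have : (1 : ℝ) ≤ n i := by exact_mod_cast hn i
    linarith
  exact (h ⟨1, by omega⟩).trans (Finset.single_le_sum
    (f := fun i : Fin g => Real.logb 2 ((n i : ℝ) + 1))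
    (fun i _ => zero_le_one.trans (h i)) (by simp))

/-! ### The balanced case -/

theorem logRest_le_of_mmsGuaranteed {g p : ℕ} (hg : 2 ≤ g) {n : Fin g → ℕ} (hn : ∀ i, 1 ≤ n i)
    (hanti : Antitone n) (hp : 0 < p) (h : MMSGuaranteed n p) : logRest n ≤ 8 * p := by
  have hsum := sum_le_of_mmsGuaranteed h fun i => canDemand_log (hn i) hp one_pos
  rw [← Finset.add_sum_erase _ _ (Finset.mem_univ (⟨0, by omega⟩ : Fin g)),
    ← filter_val_ne_zero hg] at hsum
  simp only [Nat.div_one, one_mul] at hsum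
  -- A second group demanding more than half of the items would make the largest group do so too.
  have hcap : ∀ i : Fin g, i.val ≠ 0 → Nat.log 16 (n i) < p := by
    intro i hi
    by_contra! hle
    have h0 : p ≤ Nat.log 16 (n ⟨0, by omega⟩) :=
      hle.trans (Nat.log_mono_right (hanti (Fin.mk_le_of_le_val (Nat.zero_le _))))
    have hsingle := Finset.single_le_sum (f := fun i => min p (Nat.log 16 (n i)) + 1)
      (fun _ _ => Nat.zero_le _) (show i ∈ Finset.univ.filter fun i : Fin g => i.val ≠ 0 by
        simpa using hi)
    simp only [min_eq_left hle] at hsingle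
    rw [min_eq_left h0] at hsum
    omega
  have hrest : ∑ i : Fin g with i.val ≠ 0, (Nat.log 16 (n i) + 1) ≤ 2 * p := by
    rw [Finset.sum_congr rfl fun i hi => by
      rw [← min_eq_right (hcap i (Finset.mem_filter.mp hi).2).le]]
    omega
  have hrest' : ∑ i : Fin g with i.val ≠ 0, ((Nat.log 16 (n i) : ℝ) + 1) ≤ 2 * p := by
    exact_mod_cast hrest
  calc logRest n ≤ ∑ i : Fin g with i.val ≠ 0, 4 * ((Nat.log 16 (n i) : ℝ) + 1) := by
        rw [logRest_eq_sum]
        refine Finset.sum_le_sum fun i _ => ?_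
        simpa using logb_add_one_le (n := n i) one_pos
    _ ≤ 8 * p := by
        rw [← Finset.mul_sum]
        linarith

/-! ### The unbalanced case -/

theorem choose_mul_le_pow (p k : ℕ) : (((p * k).choose p : ℕ) : ℝ) ≤ (4 * k) ^ p := by
  have h1 := Nat.choose_le_pow_div (α := ℝ) p (p * k)
  have h2 := Real.pow_div_factorial_le_exp (p : ℝ) (Nat.cast_nonneg p) p
  have h3 : Real.exp (p : ℝ) ≤ 4 ^ p := by
    rw [← Real.exp_one_pow]
    exact pow_le_pow_left₀ (Real.exp_pos _).le (by linarith [Real.exp_one_lt_d9]) p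
  calc _ ≤ ((p * k : ℕ) : ℝ) ^ p / (p.factorial : ℝ) := h1
    _ = (p : ℝ) ^ p / p.factorial * (k : ℝ) ^ p := by
        push_cast
        rw [mul_pow]
        ring
    _ ≤ 4 ^ p * (k : ℝ) ^ p := by
        gcongr
        exact h2.trans h3
    _ = _ := (mul_pow _ _ _).symm

/-- If the first group contains an agent for each set of `p` among the `2 * p * q` items, then the
other groups cannot demand `p` items altogether. -/
theorem sum_log_lt_of_mmsGuaranteed {g p q : ℕ} (hg : 2 ≤ g) {n : Fin g → ℕ} (hn : ∀ i, 1 ≤ n i)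
    (hp : 0 < p) (hq : 0 < q) (h : MMSGuaranteed n p)
    (h0 : (q * (2 * p)).choose p ≤ n ⟨0, by omega⟩) :
    ∑ i : Fin g with i.val ≠ 0, q * (Nat.log 16 (n i / q) + 1) < p := by
  have hpm : p ≤ q * (2 * p) := by nlinarith
  have hsum := sum_le_of_mmsGuaranteed (m := q * (2 * p))
    (t := fun i => if i.val = 0 then q * (2 * p) - p + 1 else
      q * (min p (Nat.log 16 (n i / q)) + 1)) h (by
    intro i
    split_ifs with hi
    · have : i = ⟨0, by omega⟩ := Fin.ext hi
      rw [this]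
      exact canDemand_of_choose_le hp hpm h0
    · exact canDemand_log (hn i) hp hq)
  rw [← Finset.add_sum_erase _ _ (Finset.mem_univ (⟨0, by omega⟩ : Fin g)),
    ← filter_val_ne_zero hg, if_pos rfl,
    Finset.sum_congr rfl fun i hi => if_neg (Finset.mem_filter.mp hi).2] at hsum
  have hlt : ∑ i : Fin g with i.val ≠ 0, q * (min p (Nat.log 16 (n i / q)) + 1) < p := by
    simp only [ne_eq] at hsum ⊢
    omega
  refine lt_of_eq_of_lt (Finset.sum_congr rfl fun i hi => ?_) hlt
  have h1 := (Finset.single_le_sum (f := fun i => q * (min p (Nat.log 16 (n i / q)) + 1))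
    (fun _ _ => Nat.zero_le _) hi).trans_lt hlt
  have h2 : min p (Nat.log 16 (n i / q)) + 1 ≤ q * (min p (Nat.log 16 (n i / q)) + 1) :=
    Nat.le_mul_of_pos_left _ hq
  have h3 : min p (Nat.log 16 (n i / q)) < p := by
    omega
  rw [min_eq_right (by omega)]

theorem logFirst_div_le_of_mmsGuaranteed {g p : ℕ} (hg : 2 ≤ g) {n : Fin g → ℕ}
    (hn : ∀ i, 1 ≤ n i) (hβ : 1000 < betaOne hg n) (hp : 0 < p) (h : MMSGuaranteed n p) :
    logFirst hg n / Real.logb 2 (betaOne hg n) ≤ 8 * p := by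
  set β := betaOne hg n with hβdef
  have hR : 1 ≤ logRest n := one_le_logRest hg hn
  have hL : logFirst hg n = β * logRest n := by
    rw [hβdef, betaOne, div_mul_cancel₀ _ (by linarith)]
  set b := Real.logb 2 β with hb
  have hb1 : 1 ≤ b := by
    rw [hb, Real.le_logb_iff_rpow_le (by norm_num) (by linarith), Real.rpow_one]
    linarith
  by_contra! hlt
  rw [lt_div_iff₀ (by linarith)] at hlt
  set q := ⌈β⌉₊ with hq
  have hβq : β ≤ q := Nat.le_ceil β
  have hqβ : (q : ℝ) < β + 1 := Nat.ceil_lt_add_one (by linarith)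
  have hq0 : 0 < q := Nat.ceil_pos.mpr (by linarith)
  have hq0' : (0 : ℝ) < q := by exact_mod_cast hq0
  have hlogq : Real.logb 2 q ≤ 2 * b := by
    have : (q : ℝ) ≤ β ^ 2 := by nlinarith
    calc _ ≤ Real.logb 2 (β ^ 2) := Real.logb_le_logb_of_le (by norm_num) hq0' this
      _ = _ := by rw [Real.logb_pow]; norm_num [hb]
  have h0 : (q * (2 * p)).choose p ≤ n ⟨0, by omega⟩ := by
    have hlog : Real.logb 2 (8 * q) ≤ 2 * b := by
      have : 8 * (q : ℝ) ≤ β ^ 2 := by nlinarith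
      calc _ ≤ Real.logb 2 (β ^ 2) :=
            Real.logb_le_logb_of_le (by norm_num) (by positivity) this
        _ = _ := by rw [Real.logb_pow]; norm_num [hb]
    -- The bound is strict in terms of `n ⟨0, _⟩ + 1`, so it holds in terms of `n ⟨0, _⟩`.
    have hpow : ((8 * q : ℝ)) ^ p < (n ⟨0, by omega⟩ : ℝ) + 1 := by
      rw [← Real.logb_lt_logb_iff (b := 2) (by norm_num) (by positivity) (by positivity),
        Real.logb_pow]
      have : (p : ℝ) * Real.logb 2 (8 * q) ≤ p * (2 * b) := by gcongr
      have hpb : 0 ≤ (p : ℝ) * b := by positivity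
      change _ < logFirst hg n
      nlinarith
    have hch := choose_mul_le_pow p (2 * q)
    rw [show p * (2 * q) = q * (2 * p) by ring] at hch
    push_cast at hch
    rw [show (4 * (2 * (q : ℝ))) = 8 * q by ring] at hch
    have := hch.trans_lt hpow
    exact Nat.lt_succ_iff.mp (by exact_mod_cast this)
  have hsum := sum_log_lt_of_mmsGuaranteed hg hn hp hq0 h h0
  have hsum' : ∑ i : Fin g with i.val ≠ 0, (q : ℝ) * ((Nat.log 16 (n i / q) : ℝ) + 1) < p := by
    exact_mod_cast hsum
  rw [← Finset.mul_sum] at hsum'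
  -- Where `log (n i + 1) ≤ 4 * b`, the summand `1` suffices; elsewhere `log q` is at most half of
  -- `log (n i + 1)`, so the division by `q` is harmless.
  have hterm : ∀ i, Real.logb 2 ((n i : ℝ) + 1) ≤ 8 * b * ((Nat.log 16 (n i / q) : ℝ) + 1) := by
    intro i
    have h1 := logb_add_one_le (n := n i) hq0
    have h2 : (0 : ℝ) ≤ Nat.log 16 (n i / q) := Nat.cast_nonneg _
    rcases le_total (Real.logb 2 ((n i : ℝ) + 1)) (4 * b) with h3 | h3 <;> nlinarith
  have hRle : logRest n ≤ 8 * b * ∑ i : Fin g with i.val ≠ 0, ((Nat.log 16 (n i / q) : ℝ) + 1) := by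
    rw [logRest_eq_sum, Finset.mul_sum]
    exact Finset.sum_le_sum fun i _ => hterm i
  have : logFirst hg n ≤ 8 * b * p := by
    calc logFirst hg n = β * logRest n := hL
      _ ≤ q * (8 * b * ∑ i : Fin g with i.val ≠ 0, ((Nat.log 16 (n i / q) : ℝ) + 1)) := by
          gcongr
      _ = 8 * b * (q * ∑ i : Fin g with i.val ≠ 0, ((Nat.log 16 (n i / q) : ℝ) + 1)) := by ring
      _ ≤ 8 * b * p := by gcongr
  linarith

theorem theorem1p2 :
    (∃ c : ℝ, 0 < c ∧
      ∀ (g : ℕ) (hg : 2 ≤ g) (n : Fin g → ℕ), (∀ i, 1 ≤ n i) → Antitone n →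
        betaOne hg n ≤ 1000 →
          c * logAll n ≤ (pMMS n : ℝ)) ∧
    (∃ c : ℝ, 0 < c ∧
      ∀ δ : ℝ, 0 < δ → δ < 1 → ∃ N₀ : ℕ,
        ∀ (g : ℕ) (hg : 2 ≤ g) (n : Fin g → ℕ), (∀ i, 1 ≤ n i) → Antitone n →
          1000 < betaOne hg n →
          (g : ℝ) ≤ (Real.logb 2 ((∑ i, n i : ℕ) : ℝ)) ^ (1 - δ) →
          N₀ ≤ ∑ i, n i →
            c * (logFirst hg n / Real.logb 2 (betaOne hg n)) ≤ (pMMS n : ℝ)) := by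
  refine ⟨⟨1 / 8008, by norm_num, fun g hg n hn hanti hβ => ?_⟩,
    ⟨1 / 8, by norm_num, fun _ _ _ => ⟨0, fun g hg n hn _ hβ _ _ => ?_⟩⟩⟩
  · obtain ⟨hp, h⟩ := pMMS_pos_and_mmsGuaranteed hg hn
    have hR := one_le_logRest hg hn
    have hle := logRest_le_of_mmsGuaranteed hg hn hanti hp h
    rw [betaOne, div_le_iff₀ (by linarith)] at hβ
    rw [logAll_eq_add hg]
    linarith
  · obtain ⟨hp, h⟩ := pMMS_pos_and_mmsGuaranteed hg hn
    linarith [logFirst_div_le_of_mmsGuaranteed hg hn hβ hp h]
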